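/- Notation. For an integer $d\ge 1$ and $f\in L^1(\mathbb R^d)$ (complex-valued) put $\hat f(\xi)=(2\pi)^{-d/2}\int_{\mathbb R^d}e^{-i\xi\cdot x}f(x)\,dx$. For $k\in\mathbb N_0$ let $h_k(x)=(-1)^k(2^k k!\sqrt\pi)^{-1/2}e^{x^2/2}\frac{d^k}{dx^k}e^{-x^2}$ be the Hermite functions on $\mathbb R$, and for $\alpha\in\mathbb N_0^d$ let $\mathbf h_\alpha(x)=\prod_{j=1}^d h_{\alpha_j}(x_j)$. Write $\langle f,\mathbf h_\alpha\rangle=\int_{\mathbb R^d} f\,\mathbf h_\alpha\,dx$. For $0<s<\frac12$ let $w_s(x)=(\log(1+|x|))^{\frac1{1-2s}}$, and for $\lambda>0$ let $E^d_{\mathcal F}(1,1,\lambda,w_s)$ be the set of $f\in L^1(\mathbb R^d)\cap L^2(\mathbb R^d)$ for which there is a constant $C$ with $$|f(x)|\le C e^{-\frac{|x|^2}{2}+\lambda w_s(|x|)}\ \text{ for a.e. } x,\qquad |\hat f(\xi)|\le C e^{-\frac{|\xi|^2}{2}+\lambda w_s(|\xi|)}\ \text{ for all } \xi. \qquad (*)$$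 Theorem 1.2. Let $0<s<\frac12$ and $\lambda>0$. (1) There is a constant $K>0$ depending only on $s,\lambda$ such that for every $\epsilon>0$, every $f\in E^1_{\mathcal F}(1,1,\lambda,w_s)$, every $C$ satisfying $(*)$ for $f$, and every $n\in\mathbb N_0$, $$|\langle f,h_n\rangle|\le K\,C\,\exp\!\Big(-(1-\epsilon)\Big(\tfrac{1-2s}{\lambda}\Big)^{\frac{1-2s}{2s}} s\, n^{\frac1{2s}}\Big).$$ (2) For every integer $d\ge1$ there is a constant $K>0$ depending only on $s,\lambda,d$ such that for every $\epsilon>0$, every $f\in E^d_{\mathcal F}(1,1,\lambda,w_s)$, every $C$ satisfying $(*)$ for $f$, and every $\alpha\in\mathbb N_0^d$, $$|\langle f,\mathbf h_\alpha\rangle|\le K\,C\,\exp\!\Big(-(1-\epsilon)\Big(\tfrac{1-2s}{\lambda}\Big)^{\frac{1-2s}{2s}}\frac{s}{2d}\sum_{j=1}^d\alpha_j^{\frac1{2s}}\Big).$$ -/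

import Mathlib

open MeasureTheory

noncomputable section

/-- The unitary Fourier transform `(2π)^(-d/2) ∫ e^{-i ξ·x} f(x) dx` on a Euclidean space of
dimension `d`. -/
def unitaryFourier {E : Type*} [NormedAddCommGroup E] [InnerProductSpace ℝ E] [MeasureSpace E]
    (f : E → ℂ) (ξ : E) : ℂ :=
  (((2 * Real.pi) ^ (-(Module.finrank ℝ E : ℝ) / 2) : ℝ) : ℂ) *
    ∫ x : E, Complex.exp (-Complex.I * ((inner ℝ ξ x : ℝ) : ℂ)) * f x

/-- `C` is an admissible constant in the two weighted Gaussian bounds for `f` and its Fourier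
transform. As `f` stands for a class in `L¹ ∩ L²`, its own bound is asked almost everywhere. -/
def IsHardyConstant {E : Type*} [NormedAddCommGroup E] [InnerProductSpace ℝ E] [MeasureSpace E]
    (a c lam : ℝ) (w : ℝ → ℝ) (f : E → ℂ) (C : ℝ) : Prop :=
  (∀ᵐ x : E, ‖f x‖ ≤ C * Real.exp (-(a * ‖x‖ ^ 2 / 2) + lam * w (c * ‖x‖))) ∧
  (∀ ξ : E, ‖unitaryFourier f ξ‖ ≤ C * Real.exp (-(a * ‖ξ‖ ^ 2 / 2) + lam * w (c * ‖ξ‖)))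

/-- The weighted Hardy class on the Euclidean space `E`. -/
def weightedHardyClass (E : Type*) [NormedAddCommGroup E] [InnerProductSpace ℝ E] [MeasureSpace E]
    (a c lam : ℝ) (w : ℝ → ℝ) : Set (E → ℂ) :=
  {f | MemLp f 1 volume ∧ MemLp f 2 volume ∧ ∃ C : ℝ, IsHardyConstant a c lam w f C}

/-- The weight `(log (1 + |x|))^(1 / (1 - 2s))`. -/
def logWeight (s : ℝ) (x : ℝ) : ℝ :=
  Real.log (1 + |x|) ^ (1 / (1 - 2 * s))

/-- The normalized Hermite function `h_k` on the line. -/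
def hermiteFun (k : ℕ) (x : ℝ) : ℝ :=
  (-1) ^ k * (2 ^ k * (Nat.factorial k : ℝ) * Real.sqrt Real.pi) ^ (-(1 / 2) : ℝ) *
    Real.exp (x ^ 2 / 2) * iteratedDeriv k (fun y : ℝ => Real.exp (-y ^ 2)) x

/-- The tensor product Hermite function `h_α` on `ℝ^d`. -/
def hermiteFunMulti {d : ℕ} (α : Fin d → ℕ) (x : EuclideanSpace ℝ (Fin d)) : ℝ :=
  ∏ j, hermiteFun (α j) (x j)

/-- The `L²` pairing `⟨f, h⟩` of `f` with a real-valued function `h`. -/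
def pairing {E : Type*} [MeasureSpace E] (f : E → ℂ) (h : E → ℝ) : ℂ :=
  ∫ x : E, f x * (h x : ℂ)

end

/-!
The Hermite coefficients of `f` are, up to factorials, the Taylor coefficients of the entire function
`F ζ = ∫ f(x) ∏ exp (-x_i² / 2 - 2 x_i ζ_i - ζ_i²) dx` (a rescaled Bargmann transform), so it is
enough to bound `F` on polycircles (`norm_pairing_hermiteFunMulti_le`).

Completing the square, the decay of `f` gives `|F| ≤ K C exp (y² + μ (log (1 + |x|)) ^ p)` as a
function of one variable `x + i y`, the others staying in the unit disc; here `p = 1 / (1 - 2 s)` and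
`μ` is slightly larger than `lam` (`exists_norm_integral_gaussKernel_le`). The Fourier transform acts
on the kernel by `ζ ↦ i ζ` (`unitaryFourier_gaussKernel`), so the decay of the transform of `f` gives
the same bound with `x` and `y` exchanged. In a quadrant the weight is dominated by the real part of
the holomorphic function `κ (log (L + 2 z)) ^ p`, with `κ` slightly larger than `μ`; what remains is
bounded by `M exp (y²)` and by `M exp (x²)`, hence by `M`, by Phragmén–Lindelöf at the critical order
(`norm_le_of_quadrant_of_gaussian_bounds`). So `F` grows only like `exp (κ T ^ p)` on the circle of
radius `exp T` (`exists_norm_le_of_gaussian_bounds`).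

Cauchy's estimate bounds the coefficient of order `n` by a power of `n!` times
`exp (κ T ^ p - n T)`, and the best `T` gives the exponent
`-2 s ((1 - 2 s) / κ) ^ ((1 - 2 s) / (2 s)) n ^ (1 / (2 s))` (`exists_mul_rpow_sub_mul_eq`). This is
almost twice the exponent needed in dimension one, and since `1 / (2 s) > 1` the excess absorbs the
factorials and the passage from `lam` to `κ`, even with `ε = 0`. In dimension `d` only the variable
with the largest index `n` is used: the sum of the `α_j ^ (1 / (2 s))` is at most `d n ^ (1 / (2 s))`.
-/

noncomputable section

/-! ### Powers of sums and of logarithms -/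

/-- Up to a factor `ρ > 1` on the first summand, `x ↦ x ^ p` is subadditive. -/
theorem exists_add_rpow_le {p ρ : ℝ} (hp : 0 < p) (hρ : 1 < ρ) :
    ∃ B : ℝ, 0 ≤ B ∧ ∀ a b : ℝ, 0 ≤ a → 0 ≤ b → (a + b) ^ p ≤ ρ * a ^ p + B * b ^ p := by
  set η : ℝ := ρ ^ (1 / p) - 1 with hη
  have hη0 : 0 < η := by
    have : 1 < ρ ^ (1 / p) := Real.one_lt_rpow hρ (by positivity)
    linarith
  refine ⟨(1 / η + 1) ^ p, by positivity, fun a b ha hb => ?_⟩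
  have h1 : 0 ≤ ρ * a ^ p := by positivity
  have h2 : 0 ≤ (1 / η + 1) ^ p * b ^ p := by positivity
  rcases le_total b (η * a) with h | h
  · calc (a + b) ^ p ≤ (ρ ^ (1 / p) * a) ^ p :=
          Real.rpow_le_rpow (by positivity) (by rw [hη] at h; linarith) hp.le
      _ = ρ * a ^ p := by
          rw [Real.mul_rpow (by positivity) ha, ← Real.rpow_mul (by positivity),
            one_div_mul_cancel hp.ne', Real.rpow_one]
      _ ≤ _ := by linarith
  · calc (a + b) ^ p ≤ ((1 / η + 1) * b) ^ p := by
          refine Real.rpow_le_rpow (by positivity) ?_ hp.le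
          have : a ≤ b / η := by rw [le_div_iff₀ hη0]; linarith
          calc a + b ≤ b / η + b := by linarith
            _ = _ := by ring
      _ = (1 / η + 1) ^ p * b ^ p := Real.mul_rpow (by positivity) hb
      _ ≤ _ := by linarith

/-- Complex powers are multiplicative when one factor is a positive real. -/
theorem ofReal_mul_cpow {r : ℝ} (hr : 0 < r) {z : ℂ} (hz : z ≠ 0) (w : ℂ) :
    ((r : ℂ) * z) ^ w = (r : ℂ) ^ w * z ^ w := by
  have hr' : (r : ℂ) ≠ 0 := by exact_mod_cast hr.ne'
  rw [Complex.cpow_def_of_ne_zero (mul_ne_zero hr' hz), Complex.cpow_def_of_ne_zero hr',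
    Complex.cpow_def_of_ne_zero hz, Complex.log_ofReal_mul hr hz, ← Complex.exp_add,
    ← Complex.ofReal_log hr.le, add_mul]

/-- High up to the right in a horizontal strip, `Re (w ^ p)` is almost `(Re w) ^ p`. -/
theorem exists_rpow_re_le_re_cpow {p ρ : ℝ} (hρ : 1 < ρ) :
    ∃ N : ℝ, 0 < N ∧ ∀ w : ℂ, N ≤ w.re → |w.im| ≤ Real.pi →
      w.re ^ p ≤ ρ * (w ^ (p : ℂ)).re := by
  have hc : ContinuousAt (fun t : ℝ => ((1 + t * Complex.I : ℂ) ^ (p : ℂ)).re) 0 := by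
    refine Complex.continuous_re.continuousAt.comp ?_
    refine ContinuousAt.cpow (by fun_prop) continuousAt_const ?_
    simp
  have h0 : ρ⁻¹ < ((1 + (0 : ℝ) * Complex.I : ℂ) ^ (p : ℂ)).re := by
    simpa using inv_lt_one_of_one_lt₀ hρ
  obtain ⟨δ, hδ, h⟩ := Metric.eventually_nhds_iff.1 (hc.eventually (lt_mem_nhds h0))
  refine ⟨Real.pi / δ + 1, by positivity, fun w hw him => ?_⟩
  have hwre : 0 < w.re := lt_of_lt_of_le (by positivity) hw
  have hlt : dist (w.im / w.re) 0 < δ := by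
    rw [dist_zero_right, Real.norm_eq_abs, abs_div, abs_of_pos hwre, div_lt_iff₀ hwre]
    have : Real.pi / δ < w.re := by linarith
    rw [div_lt_iff₀ hδ] at this
    linarith
  have h1 := (h hlt).le
  have hw1 : (1 + (w.im / w.re : ℝ) * Complex.I : ℂ) ≠ 0 := by
    intro h; simpa using congrArg Complex.re h
  have hww : w = (w.re : ℂ) * (1 + (w.im / w.re : ℝ) * Complex.I) := by
    apply Complex.ext <;> simp
    field_simp
  have hre : (w ^ (p : ℂ)).re = w.re ^ p * ((1 + (w.im / w.re : ℝ) * Complex.I : ℂ) ^ (p : ℂ)).re := by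
    conv_lhs => rw [hww]
    rw [ofReal_mul_cpow hwre hw1, ← Complex.ofReal_cpow hwre.le, Complex.re_ofReal_mul]
  rw [hre]
  have : 1 ≤ ρ * ((1 + (w.im / w.re : ℝ) * Complex.I : ℂ) ^ (p : ℂ)).re := by
    rwa [inv_le_iff_one_le_mul₀' (by linarith)] at h1
  calc w.re ^ p = w.re ^ p * 1 := by ring
    _ ≤ w.re ^ p * (ρ * ((1 + (w.im / w.re : ℝ) * Complex.I : ℂ) ^ (p : ℂ)).re) := by gcongr
    _ = _ := by ring

/-! ### Phragmén–Lindelöf in a quadrant at the critical order -/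

/-- Phragmén–Lindelöf for functions of order two in a sector of opening less than `π / 2`. -/
theorem norm_le_of_sector {H : ℂ → ℂ} {M B a b : ℝ} (ha : 0 ≤ a) (hab : a < b)
    (hb : b ≤ Real.pi / 2) (hlt : b - a < Real.pi / 2)
    (hH : ∀ z : ℂ, 0 ≤ z.re → 0 ≤ z.im → DifferentiableAt ℂ H z)
    (hgrowth : ∀ z : ℂ, 0 ≤ z.re → 0 ≤ z.im → ‖H z‖ ≤ M * Real.exp (B * ‖z‖ ^ 2))
    (hHa : ∀ w : ℂ, w.im = a → ‖H (Complex.exp w)‖ ≤ M)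
    (hHb : ∀ w : ℂ, w.im = b → ‖H (Complex.exp w)‖ ≤ M)
    {w : ℂ} (hwa : a ≤ w.im) (hwb : w.im ≤ b) : ‖H (Complex.exp w)‖ ≤ M := by
  have hquad : ∀ ζ : ℂ, a ≤ ζ.im → ζ.im ≤ b →
      0 ≤ (Complex.exp ζ).re ∧ 0 ≤ (Complex.exp ζ).im := by
    intro ζ h1 h2
    rw [Complex.exp_re, Complex.exp_im]
    have hpi := Real.pi_pos
    exact ⟨mul_nonneg (Real.exp_pos _).le (Real.cos_nonneg_of_mem_Icc ⟨by linarith, by linarith⟩),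
      mul_nonneg (Real.exp_pos _).le (Real.sin_nonneg_of_mem_Icc ⟨by linarith, by linarith⟩)⟩
  refine PhragmenLindelof.horizontal_strip (f := fun ζ => H (Complex.exp ζ)) (a := a) (b := b)
    ?_ ⟨2, ?_, |B|, ?_⟩ hHa hHb hwa hwb
  · have hcl : closure (Complex.im ⁻¹' Set.Ioo a b) ⊆ Complex.im ⁻¹' Set.Icc a b :=
      closure_minimal (Set.preimage_mono Set.Ioo_subset_Icc_self)
        (isClosed_Icc.preimage Complex.continuous_im)
    refine DifferentiableOn.diffContOnCl fun ζ hζ => ?_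
    have h := hcl hζ
    obtain ⟨h1, h2⟩ := hquad ζ h.1 h.2
    exact ((hH _ h1 h2).comp ζ Complex.differentiableAt_exp).differentiableWithinAt
  · rw [lt_div_iff₀ (by linarith)]
    linarith
  · refine Asymptotics.IsBigO.of_bound |M| ?_
    refine Filter.Eventually.filter_mono inf_le_right ?_
    rw [Filter.eventually_principal]
    intro ζ hζ
    obtain ⟨h1, h2⟩ := hquad ζ hζ.1.le hζ.2.le
    rw [Real.norm_of_nonneg (Real.exp_pos _).le]
    refine (hgrowth _ h1 h2).trans ?_
    gcongr
    · exact le_abs_self M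
    · exact le_abs_self B
    · rw [Complex.norm_exp, ← Real.exp_nat_mul]
      refine Real.exp_le_exp.2 ?_
      push_cast
      linarith [le_abs_self ζ.re]

/-- A function of order two on the closed first quadrant, bounded by `M exp (y²)` and by
`M exp (x²)` at `x + i y`, is bounded by `M`. The order is critical for an angle `π / 2`, so the
quadrant is cut along a ray: after multiplication by `exp (i a z²)`, with `a` chosen by the slope
of the ray, both parts satisfy Phragmén–Lindelöf, and `a → 0` as the ray tends to the real axis. -/
theorem norm_le_of_quadrant_of_gaussian_bounds {G : ℂ → ℂ} {M : ℝ}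
    (hG : ∀ z : ℂ, 0 ≤ z.re → 0 ≤ z.im → DifferentiableAt ℂ G z)
    (him : ∀ z : ℂ, 0 ≤ z.re → 0 ≤ z.im → ‖G z‖ ≤ M * Real.exp (z.im ^ 2))
    (hre : ∀ z : ℂ, 0 ≤ z.re → 0 ≤ z.im → ‖G z‖ ≤ M * Real.exp (z.re ^ 2))
    {z : ℂ} (hz1 : 0 ≤ z.re) (hz2 : 0 ≤ z.im) : ‖G z‖ ≤ M := by
  have hpi := Real.pi_pos
  have hM : 0 ≤ M := by
    have := (norm_nonneg _).trans (him 0 (by simp) (by simp))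
    simpa using this
  rcases eq_or_ne z 0 with rfl | hz0
  · simpa using him 0 (by simp) (by simp)
  have key : ∀ a : ℝ, 0 < a → ‖G z‖ ≤ M * Real.exp (2 * a * (z.re * z.im)) := by
    intro a ha
    have hnorm : ∀ z : ℂ, ‖Complex.exp (Complex.I * a * z ^ 2)‖ =
        Real.exp (-(2 * a * (z.re * z.im))) := by
      intro z
      rw [Complex.norm_exp]
      congr 1
      simp [pow_two]
      ring
    set H : ℂ → ℂ := fun z => G z * Complex.exp (Complex.I * a * z ^ 2) with hHdef
    set φ : ℝ := Real.arctan (2 * a) with hφ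
    have hφ0 : 0 < φ := Real.arctan_pos.2 (by linarith)
    have hφ1 : φ < Real.pi / 2 := Real.arctan_lt_pi_div_two _
    have htan : Real.sin φ = 2 * a * Real.cos φ := by
      have h := Real.tan_arctan (2 * a)
      rw [Real.tan_eq_sin_div_cos, div_eq_iff (Real.cos_arctan_pos _).ne'] at h
      exact h
    have hHd : ∀ z : ℂ, 0 ≤ z.re → 0 ≤ z.im → DifferentiableAt ℂ H z := by
      intro z h1 h2
      exact (hG z h1 h2).mul (by fun_prop)
    have hHg : ∀ z : ℂ, 0 ≤ z.re → 0 ≤ z.im → ‖H z‖ ≤ M * Real.exp (1 * ‖z‖ ^ 2) := by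
      intro z h1 h2
      rw [hHdef]
      simp only [norm_mul, hnorm]
      calc ‖G z‖ * Real.exp (-(2 * a * (z.re * z.im))) ≤ (M * Real.exp (z.im ^ 2)) * 1 := by
            gcongr
            · exact him z h1 h2
            · rw [Real.exp_le_one_iff]
              have : 0 ≤ a * (z.re * z.im) := by positivity
              linarith
        _ ≤ M * Real.exp (1 * ‖z‖ ^ 2) := by
            rw [mul_one, one_mul, Complex.sq_norm, Complex.normSq_apply]
            gcongr
            nlinarith [sq_nonneg z.re]
    have hquad : ∀ ζ : ℂ, 0 ≤ ζ.im → ζ.im ≤ Real.pi / 2 →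
        0 ≤ (Complex.exp ζ).re ∧ 0 ≤ (Complex.exp ζ).im := by
      intro ζ h1 h2
      rw [Complex.exp_re, Complex.exp_im]
      exact ⟨mul_nonneg (Real.exp_pos _).le
          (Real.cos_nonneg_of_mem_Icc ⟨by linarith, by linarith⟩),
        mul_nonneg (Real.exp_pos _).le (Real.sin_nonneg_of_mem_Icc ⟨by linarith, by linarith⟩)⟩
    have hray : ∀ ζ : ℂ, ζ.im = φ → ‖H (Complex.exp ζ)‖ ≤ M := by
      intro ζ h
      obtain ⟨h1, h2⟩ := hquad ζ (by linarith) (by linarith)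
      simp only [hHdef, norm_mul, hnorm]
      have hslope : (Complex.exp ζ).im = 2 * a * (Complex.exp ζ).re := by
        rw [Complex.exp_re, Complex.exp_im, h, htan]
        ring
      calc _ ≤ M * Real.exp ((Complex.exp ζ).im ^ 2) *
            Real.exp (-(2 * a * ((Complex.exp ζ).re * (Complex.exp ζ).im))) := by
            gcongr
            exact him _ h1 h2
        _ = M := by
            rw [mul_assoc, ← Real.exp_add]
            have : (Complex.exp ζ).im ^ 2 +
                -(2 * a * ((Complex.exp ζ).re * (Complex.exp ζ).im)) = 0 := by
              rw [hslope]; ring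
            rw [this, Real.exp_zero, mul_one]
    have hbot : ∀ ζ : ℂ, ζ.im = 0 → ‖H (Complex.exp ζ)‖ ≤ M := by
      intro ζ h
      obtain ⟨h1, h2⟩ := hquad ζ (by linarith) (by linarith)
      have h0 : (Complex.exp ζ).im = 0 := by rw [Complex.exp_im, h]; simp
      simp only [hHdef, norm_mul, hnorm]
      simpa [h0] using him _ h1 h2
    have htop : ∀ ζ : ℂ, ζ.im = Real.pi / 2 → ‖H (Complex.exp ζ)‖ ≤ M := by
      intro ζ h
      obtain ⟨h1, h2⟩ := hquad ζ (by linarith) (by linarith)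
      have h0 : (Complex.exp ζ).re = 0 := by rw [Complex.exp_re, h]; simp
      simp only [hHdef, norm_mul, hnorm]
      simpa [h0] using hre _ h1 h2
    have hlog : Complex.exp (Complex.log z) = z := Complex.exp_log hz0
    have harg0 : 0 ≤ (Complex.log z).im := by
      rw [Complex.log_im]; exact Complex.arg_nonneg_iff.2 hz2
    have harg1 : (Complex.log z).im ≤ Real.pi / 2 := by
      rw [Complex.log_im]; exact (Complex.arg_le_pi_div_two_iff).2 (Or.inl hz1)
    have hHz : ‖H z‖ ≤ M := by
      rw [← hlog]
      rcases le_total (Complex.log z).im φ with h | h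
      · exact norm_le_of_sector le_rfl hφ0 hφ1.le (by linarith) hHd hHg hbot hray harg0 h
      · exact norm_le_of_sector hφ0.le hφ1 le_rfl (by linarith) hHd hHg hray htop h harg1
    simp only [hHdef, norm_mul, hnorm, Real.exp_neg] at hHz
    rwa [← div_eq_mul_inv, div_le_iff₀ (Real.exp_pos _)] at hHz
  have hlim : Filter.Tendsto (fun a : ℝ => M * Real.exp (2 * a * (z.re * z.im)))
      (nhdsWithin 0 (Set.Ioi 0)) (nhds M) := by
    have : Continuous fun a : ℝ => M * Real.exp (2 * a * (z.re * z.im)) := by fun_prop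
    simpa using (this.tendsto 0).mono_left nhdsWithin_le_nhds
  exact ge_of_tendsto hlim (Filter.eventually_of_mem self_mem_nhdsWithin fun a ha => key a ha)

/-! ### Entire functions with Gaussian bounds along both axes -/

/-- The real part of a power of `log (L + 2 z)` dominates the weight `(log (1 + |z|)) ^ p` on the
first quadrant, up to a factor `ρ > 1`. -/
theorem exists_log_one_add_rpow_le_re_cpow {p ρ : ℝ} (hp : 0 < p) (hρ : 1 < ρ) :
    ∃ L : ℝ, 2 ≤ L ∧ ∀ z : ℂ, 0 ≤ z.re → 0 ≤ z.im →
      Real.log (1 + ‖z‖) ^ p ≤ ρ * (Complex.log (L + 2 * z) ^ (p : ℂ)).re := by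
  obtain ⟨N, hN, h⟩ := exists_rpow_re_le_re_cpow (p := p) hρ
  refine ⟨max 2 (Real.exp N), le_max_left _ _, fun z hz1 hz2 => ?_⟩
  set L := max 2 (Real.exp N)
  have hL2 : 2 ≤ L := le_max_left _ _
  have hre : ((L : ℂ) + 2 * z).re = L + 2 * z.re := by simp
  have him : ((L : ℂ) + 2 * z).im = 2 * z.im := by simp
  have hLn : L ≤ ‖(L : ℂ) + 2 * z‖ :=
    le_trans (by rw [hre]; linarith) (Complex.re_le_norm _)
  have hnorm : 1 + ‖z‖ ≤ ‖(L : ℂ) + 2 * z‖ := by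
    refine abs_le_of_sq_le_sq' ?_ (norm_nonneg _) |>.2
    rw [Complex.sq_norm, Complex.normSq_apply, hre, him]
    have h1 : ‖z‖ ^ 2 = z.re * z.re + z.im * z.im := by
      rw [Complex.sq_norm, Complex.normSq_apply]
    nlinarith [sq_nonneg (‖z‖ - 1), mul_nonneg (by linarith : (0 : ℝ) ≤ L) hz1]
  have hw1 : N ≤ (Complex.log ((L : ℂ) + 2 * z)).re := by
    rw [Complex.log_re, ← Real.log_exp N]
    exact Real.log_le_log (Real.exp_pos _) ((le_max_right _ _).trans hLn)
  have hw2 : |(Complex.log ((L : ℂ) + 2 * z)).im| ≤ Real.pi := by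
    rw [Complex.log_im]; exact Complex.abs_arg_le_pi _
  refine le_trans ?_ (h _ hw1 hw2)
  rw [Complex.log_re]
  refine Real.rpow_le_rpow (Real.log_nonneg (by linarith [norm_nonneg z])) ?_ hp.le
  exact Real.log_le_log (by linarith [norm_nonneg z]) hnorm

/-- In the first quadrant, dividing by the exponential of `κ (log (L + 2 z)) ^ p` removes the weight
from both bounds and leaves purely Gaussian ones, to which the critical Phragmén–Lindelöf theorem
applies. -/
theorem norm_le_of_quadrant_of_log_weight {p μ κ L M : ℝ} (hμ : 0 ≤ μ) (hp : 0 < p) (hL : 2 ≤ L)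
    (hLκ : ∀ z : ℂ, 0 ≤ z.re → 0 ≤ z.im →
      μ * Real.log (1 + ‖z‖) ^ p ≤ κ * (Complex.log (L + 2 * z) ^ (p : ℂ)).re)
    {F : ℂ → ℂ} (hF : Differentiable ℂ F) (hM : 0 ≤ M)
    (him : ∀ z : ℂ, ‖F z‖ ≤ M * Real.exp (z.im ^ 2 + μ * Real.log (1 + |z.re|) ^ p))
    (hre : ∀ z : ℂ, ‖F z‖ ≤ M * Real.exp (z.re ^ 2 + μ * Real.log (1 + |z.im|) ^ p))
    {z : ℂ} (hz1 : 0 ≤ z.re) (hz2 : 0 ≤ z.im) :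
    ‖F z‖ ≤ M * Real.exp (κ * (Complex.log (L + 2 * z) ^ (p : ℂ)).re) := by
  set P : ℂ → ℂ := fun z => κ * Complex.log (L + 2 * z) ^ (p : ℂ) with hP
  have hPre : ∀ z : ℂ, (P z).re = κ * (Complex.log (L + 2 * z) ^ (p : ℂ)).re := fun z => by
    rw [hP, Complex.re_ofReal_mul]
  have hnorm : ∀ z : ℂ, ‖F z * Complex.exp (-P z)‖ = ‖F z‖ * Real.exp (-(P z).re) := fun z => by
    rw [norm_mul, Complex.norm_exp, Complex.neg_re]
  have hdiff : ∀ z : ℂ, 0 ≤ z.re → 0 ≤ z.im →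
      DifferentiableAt ℂ (fun z => F z * Complex.exp (-P z)) z := by
    intro z h1 h2
    have hpos : 1 < ((L : ℂ) + 2 * z).re := by simp; linarith
    have hlog : DifferentiableAt ℂ (fun z : ℂ => Complex.log (L + 2 * z)) z :=
      DifferentiableAt.clog (by fun_prop) (Or.inl (by linarith))
    have hlogpos : 0 < (Complex.log (L + 2 * z)).re := by
      rw [Complex.log_re]
      exact Real.log_pos (hpos.trans_le (Complex.re_le_norm _))
    have hcpow : DifferentiableAt ℂ (fun z : ℂ => Complex.log (L + 2 * z) ^ (p : ℂ)) z :=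
      hlog.cpow (differentiableAt_const _) (Or.inl hlogpos)
    exact (hF z).mul (hcpow.const_mul _).neg.cexp
  have hmono : ∀ (z : ℂ) (t : ℝ), |t| ≤ ‖z‖ → 0 ≤ z.re → 0 ≤ z.im →
      μ * Real.log (1 + |t|) ^ p ≤ (P z).re := by
    intro z t ht h1 h2
    rw [hPre]
    refine le_trans ?_ (hLκ z h1 h2)
    gcongr
    exact Real.log_nonneg (by linarith [abs_nonneg t])
  have hG := norm_le_of_quadrant_of_gaussian_bounds (M := M) hdiff
    (fun z h1 h2 => by
      rw [hnorm]
      calc _ ≤ M * Real.exp (z.im ^ 2 + μ * Real.log (1 + |z.re|) ^ p) * Real.exp (-(P z).re) := by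
            gcongr
            exact him z
        _ ≤ _ := by
            rw [mul_assoc, ← Real.exp_add]
            gcongr
            linarith [hmono z z.re (Complex.abs_re_le_norm z) h1 h2])
    (fun z h1 h2 => by
      rw [hnorm]
      calc _ ≤ M * Real.exp (z.re ^ 2 + μ * Real.log (1 + |z.im|) ^ p) * Real.exp (-(P z).re) := by
            gcongr
            exact hre z
        _ ≤ _ := by
            rw [mul_assoc, ← Real.exp_add]
            gcongr
            linarith [hmono z z.im (Complex.abs_im_le_norm z) h1 h2])
    hz1 hz2
  rw [hnorm, Real.exp_neg, ← div_eq_mul_inv, div_le_iff₀ (Real.exp_pos _), hPre] at hG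
  exact hG

/-- An entire function with the bounds `M exp (y² + μ (log (1 + |x|)) ^ p)` and
`M exp (x² + μ (log (1 + |y|)) ^ p)` at `x + i y` has no Gaussian growth at all: on the disc of
radius `exp T` it is at most a constant times `M exp (ρ μ T ^ p)`, for any `ρ > 1`. -/
theorem exists_norm_le_of_gaussian_bounds {p μ ρ : ℝ} (hp : 0 < p) (hμ : 0 ≤ μ) (hρ : 1 < ρ) :
    ∃ K : ℝ, 0 < K ∧ ∀ (F : ℂ → ℂ) (M : ℝ), Differentiable ℂ F → 0 ≤ M →
      (∀ z : ℂ, ‖F z‖ ≤ M * Real.exp (z.im ^ 2 + μ * Real.log (1 + |z.re|) ^ p)) →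
      (∀ z : ℂ, ‖F z‖ ≤ M * Real.exp (z.re ^ 2 + μ * Real.log (1 + |z.im|) ^ p)) →
      ∀ (T : ℝ) (z : ℂ), 0 ≤ T → ‖z‖ ≤ Real.exp T →
        ‖F z‖ ≤ K * M * Real.exp (ρ * μ * T ^ p) := by
  have hρ1 : 1 < √ρ := by simpa using Real.sqrt_lt_sqrt zero_le_one hρ
  have hρρ : √ρ * √ρ = ρ := Real.mul_self_sqrt (by linarith)
  obtain ⟨L, hL, hLre⟩ := exists_log_one_add_rpow_le_re_cpow hp hρ1
  obtain ⟨B, hB, hadd⟩ := exists_add_rpow_le hp hρ1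
  set D : ℝ := Real.log (L + 2) + Real.pi with hD
  have hD0 : 0 ≤ D := add_nonneg (Real.log_nonneg (by linarith)) Real.pi_pos.le
  refine ⟨Real.exp (√ρ * μ * (B * D ^ p)), Real.exp_pos _, fun F M hF hM him hre T z hT hz => ?_⟩
  -- Multiplication by `i` exchanges the two hypotheses, so one quadrant is enough.
  have hquad : ∀ (F : ℂ → ℂ), Differentiable ℂ F →
      (∀ z : ℂ, ‖F z‖ ≤ M * Real.exp (z.im ^ 2 + μ * Real.log (1 + |z.re|) ^ p)) →
      (∀ z : ℂ, ‖F z‖ ≤ M * Real.exp (z.re ^ 2 + μ * Real.log (1 + |z.im|) ^ p)) →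
      ∀ z : ℂ, 0 ≤ z.re → 0 ≤ z.im → ‖z‖ ≤ Real.exp T →
        ‖F z‖ ≤ Real.exp (√ρ * μ * (B * D ^ p)) * M * Real.exp (ρ * μ * T ^ p) := by
    intro F hF him hre z hz1 hz2 hz
    refine (norm_le_of_quadrant_of_log_weight (κ := √ρ * μ) hμ hp hL (fun z h1 h2 => ?_) hF hM
      him hre hz1 hz2).trans ?_
    · calc _ ≤ μ * (√ρ * (Complex.log (L + 2 * z) ^ (p : ℂ)).re) := by
            gcongr; exact hLre z h1 h2
        _ = _ := by ring
    · have hone : 1 ≤ ‖(L : ℂ) + 2 * z‖ :=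
        le_trans (by simp; linarith) (Complex.re_le_norm _)
      have hupper : ‖(L : ℂ) + 2 * z‖ ≤ (L + 2) * Real.exp T := by
        have h1 : 1 ≤ Real.exp T := Real.one_le_exp hT
        calc ‖(L : ℂ) + 2 * z‖ ≤ ‖(L : ℂ)‖ + ‖2 * z‖ := norm_add_le _ _
          _ = L + 2 * ‖z‖ := by
              rw [norm_mul, Complex.norm_real, Real.norm_of_nonneg (by linarith)]; simp
          _ ≤ _ := by nlinarith
      have hW : ‖Complex.log ((L : ℂ) + 2 * z)‖ ≤ T + D := by
        refine (Complex.norm_le_abs_re_add_abs_im _).trans ?_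
        rw [Complex.log_re, Complex.log_im, abs_of_nonneg (Real.log_nonneg hone)]
        have h2 : Real.log ‖(L : ℂ) + 2 * z‖ ≤ Real.log (L + 2) + T := by
          rw [← Real.log_exp T, ← Real.log_mul (by linarith) (Real.exp_pos _).ne']
          exact Real.log_le_log (by linarith) hupper
        linarith [Complex.abs_arg_le_pi ((L : ℂ) + 2 * z)]
      have hWp : (Complex.log ((L : ℂ) + 2 * z) ^ (p : ℂ)).re ≤ √ρ * T ^ p + B * D ^ p := by
        refine (Complex.re_le_norm _).trans ?_
        rw [Complex.norm_cpow_real]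
        exact (Real.rpow_le_rpow (norm_nonneg _) hW hp.le).trans (hadd T D hT hD0)
      calc M * Real.exp (√ρ * μ * (Complex.log ((L : ℂ) + 2 * z) ^ (p : ℂ)).re)
          ≤ M * Real.exp (√ρ * μ * (√ρ * T ^ p + B * D ^ p)) := by gcongr
        _ = M * (Real.exp (√ρ * μ * (B * D ^ p)) * Real.exp (√ρ * √ρ * μ * T ^ p)) := by
            rw [← Real.exp_add]; ring_nf
        _ = _ := by rw [hρρ]; ring
  have hrot : ∀ (F : ℂ → ℂ), Differentiable ℂ F →
      (∀ z : ℂ, ‖F z‖ ≤ M * Real.exp (z.im ^ 2 + μ * Real.log (1 + |z.re|) ^ p)) →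
      (∀ z : ℂ, ‖F z‖ ≤ M * Real.exp (z.re ^ 2 + μ * Real.log (1 + |z.im|) ^ p)) →
      ∀ z : ℂ, 0 ≤ z.re → ‖z‖ ≤ Real.exp T →
        ‖F z‖ ≤ Real.exp (√ρ * μ * (B * D ^ p)) * M * Real.exp (ρ * μ * T ^ p) := by
    intro F hF him hre z hz1 hz
    rcases le_total 0 z.im with h | h
    · exact hquad F hF him hre z hz1 h hz
    · have := hquad (fun z => F (-Complex.I * z)) (hF.comp (by fun_prop))
        (fun w => by simpa using hre (-Complex.I * w)) (fun w => by simpa using him (-Complex.I * w))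
        (Complex.I * z) (by simpa using h) (by simpa using hz1) (by simpa using hz)
      simpa [← mul_assoc] using this
  rcases le_total 0 z.re with h | h
  · exact hrot F hF him hre z h hz
  · have := hrot (fun z => F (-z)) (hF.comp (by fun_prop))
      (fun w => by simpa using him (-w)) (fun w => by simpa using hre (-w))
      (-z) (by simpa using h) (by simpa using hz)
    simpa using this

/-! ### The Gaussian generating kernel -/

/-- The kernel `∏ exp (-x_i² / 2 - 2 x_i ζ_i - ζ_i²)`. Up to the change of variable `ζ ↦ -√2 ζ` it is
the kernel of the Bargmann transform, and its Taylor coefficients in `ζ` are multiples of the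
Hermite functions. -/
def gaussKernel {ι : Type*} [Fintype ι] (ζ : ι → ℂ) (x : EuclideanSpace ℝ ι) : ℂ :=
  Complex.exp (∑ i, (-(x i : ℂ) ^ 2 / 2 - 2 * x i * ζ i - ζ i ^ 2))

section Kernel

variable {ι : Type*} [Fintype ι]

theorem Continuous.gaussKernel {X : Type*} [TopologicalSpace X] {ζ : X → ι → ℂ}
    {x : X → EuclideanSpace ℝ ι} (hζ : Continuous ζ) (hx : Continuous x) :
    Continuous fun t => gaussKernel (ζ t) (x t) := by
  unfold _root_.gaussKernel
  fun_prop

theorem gaussKernel_term_re (t : ℝ) (z : ℂ) :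
    (-(t : ℂ) ^ 2 / 2 - 2 * t * z - z ^ 2).re = -(t ^ 2 / 2) - 2 * t * z.re - z.re ^ 2 + z.im ^ 2 := by
  have h : (-(t : ℂ) ^ 2 / 2) = ((-(t ^ 2 / 2) : ℝ) : ℂ) := by push_cast; ring
  rw [h]
  simp [pow_two]
  ring

theorem norm_gaussKernel (ζ : ι → ℂ) (x : EuclideanSpace ℝ ι) :
    ‖gaussKernel ζ x‖ = Real.exp (-‖x + WithLp.toLp 2 fun i => (ζ i).re‖ ^ 2 + ‖x‖ ^ 2 / 2 +
      ∑ i, (ζ i).im ^ 2) := by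
  rw [gaussKernel, Complex.norm_exp, Complex.re_sum]
  congr 1
  simp only [gaussKernel_term_re, EuclideanSpace.norm_sq_eq, Real.norm_eq_abs, sq_abs,
    PiLp.add_apply, Finset.sum_div, ← Finset.sum_neg_distrib, ← Finset.sum_add_distrib]
  refine Finset.sum_congr rfl fun i _ => ?_
  ring

theorem norm_gaussKernel_le (ζ : ι → ℂ) (x : EuclideanSpace ℝ ι) (j : ι) :
    ‖gaussKernel ζ x‖ ≤ Real.exp (-((x j + 2 * (ζ j).re) ^ 2 / 2)) *
      Real.exp (∑ i, ‖ζ i‖ ^ 2) := by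
  rw [gaussKernel, Complex.norm_exp, Complex.re_sum, ← Real.exp_add]
  refine Real.exp_le_exp.2 ?_
  have h : ∀ i, (-(x i : ℂ) ^ 2 / 2 - 2 * x i * ζ i - ζ i ^ 2).re =
      -((x i + 2 * (ζ i).re) ^ 2 / 2) + ‖ζ i‖ ^ 2 := fun i => by
    rw [gaussKernel_term_re, Complex.sq_norm, Complex.normSq_apply]
    ring
  simp only [h, Finset.sum_add_distrib]
  gcongr
  rw [Finset.sum_neg_distrib, neg_le_neg_iff]
  exact Finset.single_le_sum (f := fun i => (x i + 2 * (ζ i).re) ^ 2 / 2)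
    (fun i _ => by positivity) (Finset.mem_univ j)

/-- Integrating a function with Gaussian decay against the kernel: completing the square leaves a
translated Gaussian, and translating the weight costs only a factor `ρ > 1`. The parameters other
than the `j`-th are confined to the unit disc. -/
theorem exists_norm_integral_gaussKernel_le {p ρ lam : ℝ} (hp : 0 < p) (hρ : 1 < ρ)
    (hlam : 0 ≤ lam) :
    ∃ K : ℝ, 0 < K ∧ ∀ (g : EuclideanSpace ℝ ι → ℂ) (C : ℝ),
      (∀ᵐ x, ‖g x‖ ≤ C * Real.exp (-(‖x‖ ^ 2 / 2) + lam * Real.log (1 + ‖x‖) ^ p)) → 0 ≤ C →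
      ∀ (j : ι) (ζ : ι → ℂ), (∀ i, i ≠ j → ‖ζ i‖ ≤ 1) →
        ‖∫ x, g x * gaussKernel ζ x‖ ≤
          K * C * Real.exp ((ζ j).im ^ 2 + ρ * lam * Real.log (1 + |(ζ j).re|) ^ p) := by
  classical
  obtain ⟨B, hB, hadd⟩ := exists_add_rpow_le hp hρ
  set n : ℝ := (Fintype.card ι : ℝ) with hn
  have hn0 : 0 ≤ n := by positivity
  set c : EuclideanSpace ℝ ι → ℝ := fun y =>
    Real.exp (-‖y‖ ^ 2 + lam * B * (Real.log (1 + ‖y‖) + Real.log (1 + n)) ^ p) with hc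
  have hcint : Integrable c := by
    set d : ℝ := Real.log (1 + n)
    have hd : 0 ≤ d := Real.log_nonneg (by linarith)
    have hlog : ∀ t : ℝ, 0 ≤ t → Real.log (1 + t) ^ p ≤ p ^ p * (1 + t) := by
      intro t ht
      have h := Real.log_le_rpow_div (x := 1 + t) (ε := 1 / p) (by linarith) (by positivity)
      calc Real.log (1 + t) ^ p ≤ ((1 + t) ^ (1 / p) / (1 / p)) ^ p :=
            Real.rpow_le_rpow (Real.log_nonneg (by linarith)) h hp.le
        _ = p ^ p * (1 + t) := by
            rw [div_div_eq_mul_div, div_one, Real.mul_rpow (by positivity) hp.le,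
              ← Real.rpow_mul (by linarith), one_div_mul_cancel hp.ne', Real.rpow_one, mul_comm]
    set a : ℝ := lam * B * (ρ * p ^ p) with ha
    have hgauss : Integrable fun y : EuclideanSpace ℝ ι =>
        Real.exp (a ^ 2 / 2 + a + lam * B * (B * d ^ p)) * Real.exp (-(1 / 2 * ‖y‖ ^ 2)) := by
      refine Integrable.const_mul ?_ _
      have h := (GaussianFourier.integrable_cexp_neg_mul_sq_norm_add (b := 1 / 2) (by norm_num) 0
        (0 : EuclideanSpace ℝ ι)).norm
      refine h.congr (Filter.Eventually.of_forall fun y => ?_)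
      simp only [Complex.norm_exp]
      congr 1
      have : (-(1 / 2 : ℂ) * (‖y‖ : ℂ) ^ 2 +
          0 * ((inner ℝ (0 : EuclideanSpace ℝ ι) y : ℝ) : ℂ)) =
          ((-(1 / 2 * ‖y‖ ^ 2) : ℝ) : ℂ) := by push_cast; ring
      rw [this, Complex.ofReal_re]
    refine hgauss.mono' ?_ (Filter.Eventually.of_forall fun y => ?_)
    · refine Measurable.aestronglyMeasurable ?_
      rw [hc]
      fun_prop
    · rw [Real.norm_of_nonneg (Real.exp_pos _).le, ← Real.exp_add]
      refine Real.exp_le_exp.2 ?_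
      have h1 : (Real.log (1 + ‖y‖) + d) ^ p ≤ ρ * (p ^ p * (1 + ‖y‖)) + B * d ^ p := by
        refine (hadd _ _ (Real.log_nonneg (by linarith [norm_nonneg y])) hd).trans ?_
        gcongr
        exact hlog _ (norm_nonneg y)
      have h2 : lam * B * (Real.log (1 + ‖y‖) + d) ^ p ≤
          lam * B * (ρ * (p ^ p * (1 + ‖y‖)) + B * d ^ p) := by gcongr
      have h3 : lam * B * (ρ * (p ^ p * (1 + ‖y‖)) + B * d ^ p) =
          a + a * ‖y‖ + lam * B * (B * d ^ p) := by rw [ha]; ring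
      nlinarith [sq_nonneg (a - ‖y‖)]
  refine ⟨Real.exp n * ((∫ y, c y) + 1), by
    have : 0 ≤ ∫ y, c y := integral_nonneg fun y => (Real.exp_pos _).le
    positivity, fun g C hg hC j ζ hζ => ?_⟩
  set U : EuclideanSpace ℝ ι := WithLp.toLp 2 fun i => (ζ i).re with hU
  have hUn : ‖U‖ ≤ |(ζ j).re| + n := by
    have h1 : ‖U‖ ≤ ∑ i, |(ζ i).re| := by
      rw [EuclideanSpace.norm_eq]
      refine Real.sqrt_le_iff.2 ⟨by positivity, ?_⟩
      simpa [hU] using Finset.sum_sq_le_sq_sum_of_nonneg (s := Finset.univ)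
        (f := fun i => |(ζ i).re|) (fun i _ => abs_nonneg _)
    refine h1.trans ?_
    rw [← Finset.add_sum_erase _ _ (Finset.mem_univ j)]
    gcongr
    calc ∑ i ∈ Finset.univ.erase j, |(ζ i).re| ≤ ∑ i ∈ Finset.univ.erase j, (1 : ℝ) :=
          Finset.sum_le_sum fun i hi =>
            (Complex.abs_re_le_norm _).trans (hζ i (Finset.ne_of_mem_erase hi))
      _ ≤ ∑ i : ι, (1 : ℝ) := Finset.sum_le_sum_of_subset_of_nonneg (Finset.erase_subset _ _)
            fun _ _ _ => zero_le_one
      _ = n := by simp [hn]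
  have hVn : ∑ i, (ζ i).im ^ 2 ≤ (ζ j).im ^ 2 + n := by
    rw [← Finset.add_sum_erase _ _ (Finset.mem_univ j)]
    gcongr
    calc ∑ i ∈ Finset.univ.erase j, (ζ i).im ^ 2 ≤ ∑ i ∈ Finset.univ.erase j, (1 : ℝ) :=
          Finset.sum_le_sum fun i hi => by
            rw [sq_le_one_iff_abs_le_one]
            exact (Complex.abs_im_le_norm _).trans (hζ i (Finset.ne_of_mem_erase hi))
      _ ≤ ∑ i : ι, (1 : ℝ) := Finset.sum_le_sum_of_subset_of_nonneg (Finset.erase_subset _ _)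
            fun _ _ _ => zero_le_one
      _ = n := by simp [hn]
  have hlogle : ∀ x : EuclideanSpace ℝ ι, Real.log (1 + ‖x‖) ≤
      Real.log (1 + |(ζ j).re|) + (Real.log (1 + ‖x + U‖) + Real.log (1 + n)) := by
    intro x
    have h1 : ‖x‖ ≤ ‖x + U‖ + ‖U‖ := by
      simpa using norm_sub_le (x + U) U
    rw [← Real.log_mul (by positivity) (by positivity), ← Real.log_mul (by positivity)
      (by positivity)]
    refine Real.log_le_log (by positivity) ?_
    have ha := abs_nonneg (ζ j).re
    have hb := norm_nonneg (x + U)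
    nlinarith [mul_nonneg ha hb, mul_nonneg ha hn0, mul_nonneg hb hn0,
      mul_nonneg ha (mul_nonneg hb hn0)]
  set E : ℝ := Real.exp ((ζ j).im ^ 2 + ρ * lam * Real.log (1 + |(ζ j).re|) ^ p) with hE
  have hbound : ∀ᵐ x, ‖g x * gaussKernel ζ x‖ ≤ (C * Real.exp n * E) * c (x + U) := by
    filter_upwards [hg] with x hx
    have hw : Real.log (1 + ‖x‖) ^ p ≤ ρ * Real.log (1 + |(ζ j).re|) ^ p +
        B * (Real.log (1 + ‖x + U‖) + Real.log (1 + n)) ^ p :=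
      (Real.rpow_le_rpow (Real.log_nonneg (by linarith [norm_nonneg x])) (hlogle x) hp.le).trans
        (hadd _ _ (Real.log_nonneg (by linarith [abs_nonneg (ζ j).re]))
          (add_nonneg (Real.log_nonneg (by linarith [norm_nonneg (x + U)]))
            (Real.log_nonneg (by linarith))))
    rw [norm_mul, norm_gaussKernel]
    calc _ ≤ C * Real.exp (-(‖x‖ ^ 2 / 2) + lam * Real.log (1 + ‖x‖) ^ p) *
          Real.exp (-‖x + U‖ ^ 2 + ‖x‖ ^ 2 / 2 + ∑ i, (ζ i).im ^ 2) := by gcongr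
      _ = C * Real.exp (-‖x + U‖ ^ 2 + lam * Real.log (1 + ‖x‖) ^ p + ∑ i, (ζ i).im ^ 2) := by
          rw [mul_assoc, ← Real.exp_add]; ring_nf
      _ ≤ C * Real.exp (-‖x + U‖ ^ 2 + lam * (ρ * Real.log (1 + |(ζ j).re|) ^ p +
          B * (Real.log (1 + ‖x + U‖) + Real.log (1 + n)) ^ p) + ((ζ j).im ^ 2 + n)) := by
          gcongr
      _ = _ := by
          rw [hE, hc]
          simp only [mul_assoc, ← Real.exp_add]
          ring_nf
  refine (norm_integral_le_of_norm_le ((hcint.comp_add_right U).const_mul _) hbound).trans ?_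
  rw [integral_const_mul, integral_add_right_eq_self (μ := volume) c U]
  have : 0 ≤ C * Real.exp n * E := by positivity
  calc _ ≤ C * Real.exp n * E * ((∫ y, c y) + 1) := by gcongr; linarith
    _ = _ := by ring

/-- The unitary Fourier transform turns the parameter `i ζ` of the kernel into `ζ`. -/
theorem unitaryFourier_gaussKernel (ζ : ι → ℂ) (x : EuclideanSpace ℝ ι) :
    unitaryFourier (gaussKernel fun i => Complex.I * ζ i) x = gaussKernel ζ x := by
  have hpt : ∀ v : ι → ℝ, Complex.exp (-Complex.I * ((inner ℝ x (WithLp.toLp 2 v) : ℝ) : ℂ)) *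
      gaussKernel (fun i => Complex.I * ζ i) (WithLp.toLp 2 v) =
      Complex.exp (-(1 / 2 : ℂ) * ∑ i, (v i : ℂ) ^ 2 +
        ∑ i, (-Complex.I * (x i + 2 * ζ i)) * v i) * Complex.exp (∑ i, ζ i ^ 2) := by
    intro v
    rw [gaussKernel, ← Complex.exp_add, ← Complex.exp_add]
    congr 1
    simp only [PiLp.inner_apply, RCLike.inner_apply, conj_trivial, Complex.ofReal_sum,
      Complex.ofReal_mul, Finset.mul_sum, ← Finset.sum_add_distrib]
    refine Finset.sum_congr rfl fun i _ => ?_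
    linear_combination (-ζ i ^ 2) * Complex.I_sq
  have hpi : (0 : ℝ) < 2 * Real.pi := by positivity
  rw [unitaryFourier, ← (PiLp.volume_preserving_toLp ι).integral_comp
    (MeasurableEquiv.toLp 2 _).measurableEmbedding]
  simp only [hpt]
  rw [integral_mul_const, GaussianFourier.integral_cexp_neg_mul_sum_add (by norm_num),
    finrank_euclideanSpace]
  have hconst : (((2 * Real.pi) ^ (-(Fintype.card ι : ℝ) / 2) : ℝ) : ℂ) *
      (Real.pi / (1 / 2 : ℂ)) ^ (Fintype.card ι / 2 : ℂ) = 1 := by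
    have h1 : (Real.pi / (1 / 2 : ℂ)) = ((2 * Real.pi : ℝ) : ℂ) := by push_cast; ring
    have h2 : (Fintype.card ι / 2 : ℂ) = ((Fintype.card ι / 2 : ℝ) : ℂ) := by push_cast; ring
    rw [h1, h2, ← Complex.ofReal_cpow hpi.le, ← Complex.ofReal_mul, ← Real.rpow_add hpi]
    simp [neg_div]
  rw [mul_assoc, ← mul_assoc, hconst, one_mul, ← Complex.exp_add, gaussKernel, Finset.sum_div,
    ← Finset.sum_add_distrib]
  congr 1
  refine Finset.sum_congr rfl fun i _ => ?_
  linear_combination ((x i + 2 * ζ i) ^ 2 / 2) * Complex.I_sq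

theorem integrable_gaussKernel (ζ : ι → ℂ) : Integrable (gaussKernel ζ) := by
  rw [← (PiLp.volume_preserving_toLp ι).integrable_comp_emb
    (MeasurableEquiv.toLp 2 _).measurableEmbedding]
  refine ((GaussianFourier.integrable_cexp_neg_mul_sum_add (b := 1 / 2) (by norm_num)
    fun i => -2 * ζ i).mul_const (Complex.exp (∑ i, -ζ i ^ 2))).congr
      (Filter.Eventually.of_forall fun v => ?_)
  simp only [Function.comp, gaussKernel, ← Complex.exp_add, Finset.mul_sum,
    ← Finset.sum_add_distrib]
  congr 1
  refine Finset.sum_congr rfl fun i _ => ?_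
  ring

/-- The unitary Fourier transform is symmetric for the bilinear pairing. -/
theorem integral_mul_unitaryFourier {f g : EuclideanSpace ℝ ι → ℂ} (hf : Integrable f)
    (hg : Integrable g) : ∫ x, f x * unitaryFourier g x = ∫ ξ, unitaryFourier f ξ * g ξ := by
  have h := VectorFourier.integral_fourierIntegral_smul_eq_flip (μ := volume) (ν := volume)
    (L := innerₗ (EuclideanSpace ℝ ι)) Real.continuous_probChar
    (by simpa using continuous_inner) hf hg
  have hU : ∀ (f : EuclideanSpace ℝ ι → ℂ) (ξ : EuclideanSpace ℝ ι), unitaryFourier f ξ =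
      (((2 * Real.pi) ^ (-(Module.finrank ℝ (EuclideanSpace ℝ ι) : ℝ) / 2) : ℝ) : ℂ) *
      VectorFourier.fourierIntegral Real.probChar volume (innerₗ (EuclideanSpace ℝ ι)) f ξ := by
    intro f ξ
    rw [unitaryFourier, VectorFourier.fourierIntegral_probChar]
    congr 2
    ext x
    rw [smul_eq_mul, innerₗ_apply_apply, real_inner_comm]
    ring_nf
  rw [flip_innerₗ] at h
  simp only [hU, smul_eq_mul] at h ⊢
  simp only [mul_left_comm (f _), mul_assoc, integral_const_mul, h]

theorem integral_gaussKernel_eq_fourier {f : EuclideanSpace ℝ ι → ℂ} (hf : Integrable f)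
    (ζ : ι → ℂ) :
    ∫ x, f x * gaussKernel ζ x =
      ∫ ξ, unitaryFourier f ξ * gaussKernel (fun i => Complex.I * ζ i) ξ := by
  rw [← integral_mul_unitaryFourier hf (integrable_gaussKernel _)]
  simp only [unitaryFourier_gaussKernel]

theorem differentiable_integral_gaussKernel [DecidableEq ι] {f : EuclideanSpace ℝ ι → ℂ}
    (hf : Integrable f) (ζ : ι → ℂ) (j : ι) :
    Differentiable ℂ fun z => ∫ x, f x * gaussKernel (Function.update ζ j z) x := by
  intro z₀
  have hcont : ∀ z, Continuous (gaussKernel (Function.update ζ j z)) := fun z =>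
    continuous_const.gaussKernel continuous_id
  have hsum : ∀ z : ℂ, ∑ i, ‖Function.update ζ j z i‖ ^ 2 ≤ ‖z‖ ^ 2 + ∑ i, ‖ζ i‖ ^ 2 := by
    intro z
    rw [← Finset.add_sum_erase _ _ (Finset.mem_univ j), Function.update_self]
    refine add_le_add le_rfl ?_
    refine (Finset.sum_congr rfl fun i hi => ?_).trans_le
      (Finset.sum_le_sum_of_subset_of_nonneg (Finset.erase_subset j _)
        fun i _ _ => sq_nonneg ‖ζ i‖)
    rw [Function.update_of_ne (Finset.ne_of_mem_erase hi)]
  set R : ℝ := ‖z₀‖ + 1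
  set b : ℝ := Real.exp (R ^ 2 + ∑ i, ‖ζ i‖ ^ 2)
  have hbd : ∀ (z : ℂ), ‖z‖ ≤ R → ∀ x : EuclideanSpace ℝ ι,
      ‖gaussKernel (Function.update ζ j z) x‖ ≤ Real.exp (-((x j + 2 * z.re) ^ 2 / 2)) * b := by
    intro z hz x
    refine (norm_gaussKernel_le _ x j).trans ?_
    rw [Function.update_self]
    refine mul_le_mul_of_nonneg_left (Real.exp_le_exp.2 ((hsum z).trans ?_)) (Real.exp_pos _).le
    gcongr
  have hint : Integrable fun x => f x * gaussKernel (Function.update ζ j z₀) x := by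
    refine hf.mul_bdd (c := b) (hcont z₀).aestronglyMeasurable
      (Filter.Eventually.of_forall fun x => (hbd z₀ (by simp [R]) x).trans ?_)
    refine mul_le_of_le_one_left (Real.exp_pos _).le (Real.exp_le_one_iff.2 ?_)
    have : 0 ≤ (x j + 2 * z₀.re) ^ 2 / 2 := by positivity
    linarith
  refine (hasDerivAt_integral_of_dominated_loc_of_deriv_le (μ := volume)
    (F := fun z x => f x * gaussKernel (Function.update ζ j z) x)
    (s := Metric.ball z₀ 1) (Metric.ball_mem_nhds z₀ one_pos)
    (F' := fun z x => f x * (gaussKernel (Function.update ζ j z) x * (-2 * x j - 2 * z)))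
    (bound := fun x => ‖f x‖ * ((2 + 6 * R) * b))
    (Filter.Eventually.of_forall fun z =>
      hf.aestronglyMeasurable.mul (hcont z).aestronglyMeasurable) hint ?_ ?_
    (hf.norm.mul_const _) ?_).2.differentiableAt
  · refine hf.aestronglyMeasurable.mul (Continuous.aestronglyMeasurable ?_)
    exact (hcont z₀).mul (by fun_prop)
  · refine Filter.Eventually.of_forall fun x z hz => ?_
    have hzR : ‖z‖ ≤ R := by
      have h1 : ‖z - z₀‖ < 1 := by simpa [dist_eq_norm] using hz
      have h2 : ‖z‖ ≤ ‖z₀‖ + ‖z - z₀‖ := by simpa using norm_add_le z₀ (z - z₀)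
      simp only [R]
      linarith
    have hR : 0 ≤ R := (norm_nonneg z).trans hzR
    rw [norm_mul]
    refine mul_le_mul_of_nonneg_left ?_ (norm_nonneg _)
    rw [norm_mul]
    set t : ℝ := |x j + 2 * z.re| with ht
    have hlin : ‖(-2 * (x j : ℂ) - 2 * z)‖ ≤ 2 * t + 6 * R := by
      have h1 : (-2 * (x j : ℂ) - 2 * z) = ((-2 * (x j + 2 * z.re) : ℝ) : ℂ) +
          (((4 * z.re : ℝ) : ℂ) - 2 * z) := by push_cast; ring
      have h2 : ‖(((4 * z.re : ℝ) : ℂ) - 2 * z)‖ ≤ 6 * R := by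
        refine (norm_sub_le _ _).trans ?_
        rw [Complex.norm_real, norm_mul, norm_mul, Real.norm_eq_abs, Real.norm_eq_abs]
        have := Complex.abs_re_le_norm z
        norm_num
        linarith
      rw [h1]
      refine (norm_add_le _ _).trans ?_
      rw [Complex.norm_real, Real.norm_eq_abs, abs_mul, abs_neg, abs_two]
      linarith
    have hexp : (2 * t + 6 * R) * Real.exp (-(t ^ 2 / 2)) ≤ 2 + 6 * R := by
      have h1 : t ≤ Real.exp (t ^ 2 / 2) := by
        have := Real.add_one_le_exp (t ^ 2 / 2)
        nlinarith [sq_nonneg (t - 1)]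
      have h2 : 1 ≤ Real.exp (t ^ 2 / 2) := Real.one_le_exp (by positivity)
      rw [Real.exp_neg, ← div_eq_mul_inv, div_le_iff₀ (Real.exp_pos _)]
      nlinarith
    calc _ ≤ Real.exp (-((x j + 2 * z.re) ^ 2 / 2)) * b * (2 * t + 6 * R) := by
          gcongr
          exact hbd z hzR x
      _ = (2 * t + 6 * R) * Real.exp (-(t ^ 2 / 2)) * b := by rw [ht, sq_abs]; ring
      _ ≤ _ := by gcongr
  · refine Filter.Eventually.of_forall fun x z _ => ?_
    refine HasDerivAt.const_mul _ ?_
    have hterm : HasDerivAt (fun z : ℂ => ∑ i, (-(x i : ℂ) ^ 2 / 2 -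
        2 * x i * Function.update ζ j z i - Function.update ζ j z i ^ 2)) (-2 * x j - 2 * z) z := by
      have hi : ∀ i, HasDerivAt (fun z : ℂ => -(x i : ℂ) ^ 2 / 2 -
          2 * x i * Function.update ζ j z i - Function.update ζ j z i ^ 2)
          (if i = j then -2 * x j - 2 * z else 0) z := by
        intro i
        split_ifs with h
        · subst h
          simp only [Function.update_self]
          convert! (((hasDerivAt_id z).const_mul (2 * (x i : ℂ))).const_sub
            (-(x i : ℂ) ^ 2 / 2)).sub ((hasDerivAt_id z).pow 2) using 1
          simp
        · simp only [Function.update_of_ne h]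
          exact hasDerivAt_const _ _
      simpa using HasDerivAt.fun_sum (u := Finset.univ) fun i _ => hi i
    exact hterm.cexp

end Kernel

/-! ### Cauchy's formula for Hermite coefficients -/

theorem iteratedDeriv_cexp_neg_sq_ofReal (k : ℕ) (x : ℝ) :
    iteratedDeriv k (fun z : ℂ => Complex.exp (-z ^ 2)) x =
      ((iteratedDeriv k (fun y : ℝ => Real.exp (-y ^ 2)) x : ℝ) : ℂ) := by
  induction k generalizing x with
  | zero => simp
  | succ k ih =>
    have hC : ContDiff ℂ (k + 1 : ℕ) fun z : ℂ => Complex.exp (-z ^ 2) := by fun_prop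
    have hR : ContDiff ℝ (k + 1 : ℕ) fun y : ℝ => Real.exp (-y ^ 2) := by fun_prop
    have h1 := ((hC.differentiable_iteratedDeriv k (by exact_mod_cast k.lt_succ_self)
      (x : ℂ)).hasDerivAt).comp_ofReal
    have h2 := ((hR.differentiable_iteratedDeriv k (by exact_mod_cast k.lt_succ_self)
      x).hasDerivAt).ofReal_comp
    simp only [ih] at h1
    rw [iteratedDeriv_succ, iteratedDeriv_succ]
    exact h1.unique h2

/-- Hermite functions are Taylor coefficients of the Gaussian kernel, by Cauchy's formula on a
circle of any radius. -/
theorem hermiteFun_eq_circle_integral (k : ℕ) (x : ℝ) {R : ℝ} (hR : 0 < R) :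
    (hermiteFun k x : ℂ) =
      (((-1) ^ k * (2 ^ k * (Nat.factorial k : ℝ) * √Real.pi) ^ (-(1 / 2) : ℝ) *
        (Nat.factorial k / (2 * Real.pi)) : ℝ) : ℂ) *
      ∫ θ in (0 : ℝ)..2 * Real.pi,
        Complex.exp (-(x : ℂ) ^ 2 / 2 - 2 * x * circleMap 0 R θ - circleMap 0 R θ ^ 2) *
          (circleMap 0 R θ ^ k)⁻¹ := by
  have hd : DifferentiableOn ℂ (fun z : ℂ => Complex.exp (-z ^ 2))
      (Metric.closedBall (x : ℂ) R) := by fun_prop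
  have h := hd.circleIntegral_one_div_sub_center_pow_smul hR k
  rw [iteratedDeriv_cexp_neg_sq_ofReal, circleIntegral] at h
  have hpt : ∀ θ : ℝ, deriv (circleMap (x : ℂ) R) θ • (1 / (circleMap (x : ℂ) R θ - x) ^ (k + 1)) •
      Complex.exp (-circleMap (x : ℂ) R θ ^ 2) = (Complex.I * Complex.exp (-(x : ℂ) ^ 2 / 2)) *
      (Complex.exp (-(x : ℂ) ^ 2 / 2 - 2 * x * circleMap 0 R θ - circleMap 0 R θ ^ 2) *
          (circleMap 0 R θ ^ k)⁻¹) := by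
    intro θ
    have hne : circleMap 0 R θ ≠ 0 := circleMap_ne_center hR.ne'
    have hexp : Complex.exp (-circleMap (x : ℂ) R θ ^ 2) = Complex.exp (-(x : ℂ) ^ 2 / 2) *
        Complex.exp (-(x : ℂ) ^ 2 / 2 - 2 * x * circleMap 0 R θ - circleMap 0 R θ ^ 2) := by
      rw [← Complex.exp_add, ← circleMap_sub_center]
      congr 1
      ring
    rw [deriv_circleMap, circleMap_sub_center, hexp, smul_eq_mul, smul_eq_mul]
    field_simp
    ring
  simp only [hpt] at h
  rw [intervalIntegral.integral_const_mul, smul_eq_mul] at h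
  have hexp0 : Complex.exp (-(x : ℂ) ^ 2 / 2) * Complex.exp ((x : ℂ) ^ 2 / 2) = 1 := by
    rw [← Complex.exp_add, ← Complex.exp_zero]
    congr 1
    ring
  have hfac : (Nat.factorial k : ℂ) ≠ 0 := by exact_mod_cast k.factorial_ne_zero
  have hpi : (Real.pi : ℂ) ≠ 0 := by exact_mod_cast Real.pi_ne_zero
  set J := ∫ θ in (0 : ℝ)..2 * Real.pi,
        Complex.exp (-(x : ℂ) ^ 2 / 2 - 2 * x * circleMap 0 R θ - circleMap 0 R θ ^ 2) *
          (circleMap 0 R θ ^ k)⁻¹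
  have hJ : (Nat.factorial k : ℂ) / (2 * Real.pi) * J = Complex.exp ((x : ℂ) ^ 2 / 2) *
      ((iteratedDeriv k (fun y : ℝ => Real.exp (-y ^ 2)) x : ℝ) : ℂ) := by
    have hD : ((iteratedDeriv k (fun y : ℝ => Real.exp (-y ^ 2)) x : ℝ) : ℂ) =
        (Nat.factorial k : ℂ) / (2 * Real.pi) * (Complex.exp (-(x : ℂ) ^ 2 / 2) * J) := by
      field_simp at h ⊢
      linear_combination -h
    rw [hD]
    linear_combination (-(Nat.factorial k : ℂ) / (2 * Real.pi) * J) * hexp0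
  rw [hermiteFun]
  push_cast
  rw [mul_assoc _ _ J, hJ]
  ring

/-- Cauchy's estimate for Hermite coefficients: they are controlled by the pairing with the Gaussian
kernel on a polycircle. -/
theorem norm_pairing_hermiteFunMulti_le {d : ℕ} {f : EuclideanSpace ℝ (Fin d) → ℂ}
    (hf : Integrable f) {r : Fin d → ℝ} (hr : ∀ i, 0 < r i) {S : ℝ}
    (hS : ∀ ζ : Fin d → ℂ, (∀ i, ‖ζ i‖ = r i) → ‖∫ x, f x * gaussKernel ζ x‖ ≤ S)
    (α : Fin d → ℕ) :
    ‖pairing f (hermiteFunMulti α)‖ ≤ S * ∏ i, ((Nat.factorial (α i) : ℝ) / r i ^ α i) := by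
  set c : ℕ → ℝ := fun k => (-1) ^ k * (2 ^ k * (Nat.factorial k : ℝ) * √Real.pi) ^ (-(1 / 2) : ℝ) *
        (Nat.factorial k / (2 * Real.pi)) with hc
  have hpi := Real.pi_pos
  have hcle : ∀ k, |c k| * (2 * Real.pi) ≤ Nat.factorial k := by
    intro k
    have h1 : (1 : ℝ) ≤ 2 ^ k * (Nat.factorial k : ℝ) * √Real.pi := by
      have ha : (1 : ℝ) ≤ 2 ^ k := one_le_pow₀ (by norm_num)
      have hb : (1 : ℝ) ≤ Nat.factorial k := by exact_mod_cast k.factorial_pos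
      have hs : (1 : ℝ) ≤ √Real.pi := Real.one_le_sqrt.2 (by linarith [Real.pi_gt_three])
      exact one_le_mul_of_one_le_of_one_le (one_le_mul_of_one_le_of_one_le ha hb) hs
    have h2 := Real.rpow_le_one_of_one_le_of_nonpos h1 (by norm_num : (-(1 / 2) : ℝ) ≤ 0)
    have h3 : 0 ≤ (2 ^ k * (Nat.factorial k : ℝ) * √Real.pi) ^ (-(1 / 2) : ℝ) := by positivity
    rw [hc]
    simp only [abs_mul, abs_pow, abs_neg, abs_one, one_pow, one_mul, abs_of_nonneg h3]
    rw [abs_of_nonneg (by positivity), mul_assoc, div_mul_cancel₀ _ (by positivity)]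
    exact mul_le_of_le_one_left (by positivity) h2
  set ν : Measure ℝ := volume.restrict (Set.Ioc 0 (2 * Real.pi)) with hν
  have hνu : ν Set.univ = ENNReal.ofReal (2 * Real.pi) := by simp [hν]
  set P : Measure (Fin d → ℝ) := Measure.pi fun _ => ν with hP
  have hPu : P.real Set.univ = (2 * Real.pi) ^ d := by
    rw [Measure.real, hP, Measure.pi_univ]
    simp [hνu, ENNReal.toReal_ofReal hpi.le]
  set Z : (Fin d → ℝ) → Fin d → ℂ := fun θ i => circleMap 0 (r i) (θ i) with hZ
  have hZn : ∀ θ i, ‖Z θ i‖ = r i := fun θ i => by simp [hZ, abs_of_pos (hr i)]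
  set W : (Fin d → ℝ) → ℂ := fun θ => ∏ i, (Z θ i ^ α i)⁻¹ with hW
  have hWn : ∀ θ, ‖W θ‖ = ∏ i, (r i ^ α i)⁻¹ := fun θ => by
    simp only [hW, norm_prod, norm_inv, norm_pow, hZn]
  have hker : ∀ x, (hermiteFunMulti α x : ℂ) =
      (∏ i, (c (α i) : ℂ)) * ∫ θ, gaussKernel (Z θ) x * W θ ∂P := by
    intro x
    rw [hermiteFunMulti, Complex.ofReal_prod]
    simp_rw [fun i => hermiteFun_eq_circle_integral (α i) (x i) (hr i)]
    rw [Finset.prod_mul_distrib]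
    congr 1
    simp_rw [intervalIntegral.integral_of_le (by positivity : (0 : ℝ) ≤ 2 * Real.pi)]
    rw [← integral_fintype_prod_eq_prod (μ := fun _ => ν)
      (fun i θ => Complex.exp (-(x i : ℂ) ^ 2 / 2 - 2 * x i * circleMap 0 (r i) θ -
        circleMap 0 (r i) θ ^ 2) * (circleMap 0 (r i) θ ^ α i)⁻¹)]
    simp only [gaussKernel, Complex.exp_sum, hW, Finset.prod_mul_distrib, hZ, hP]
  have hZc : Continuous Z := by
    refine continuous_pi fun i => ?_
    exact (continuous_circleMap 0 (r i)).comp (continuous_apply i)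
  have hint : Integrable (fun q : EuclideanSpace ℝ (Fin d) × (Fin d → ℝ) =>
      f q.1 * (gaussKernel (Z q.2) q.1 * W q.2)) (volume.prod P) := by
    refine (hf.comp_fst P).mul_bdd
      (c := Real.exp (∑ i, r i ^ 2) * ∏ i, (r i ^ α i)⁻¹) ?_
      (Filter.Eventually.of_forall fun q => ?_)
    · refine Continuous.aestronglyMeasurable (Continuous.mul ?_ ?_)
      · exact (hZc.comp continuous_snd).gaussKernel continuous_fst
      · refine continuous_finsetProd _ fun i _ => Continuous.inv₀ ?_ fun q => ?_
        · exact ((continuous_apply i).comp (hZc.comp continuous_snd)).pow _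
        · exact pow_ne_zero _ (circleMap_ne_center (hr i).ne')
    · rw [norm_mul, hWn]
      refine mul_le_mul_of_nonneg_right ?_ (Finset.prod_nonneg fun i _ => ?_)
      · rw [gaussKernel, Complex.norm_exp, Complex.re_sum]
        refine Real.exp_le_exp.2 (Finset.sum_le_sum fun i _ => ?_)
        rw [gaussKernel_term_re, ← hZn q.2 i, Complex.sq_norm, Complex.normSq_apply]
        nlinarith [sq_nonneg (q.1 i + 2 * (Z q.2 i).re)]
      · have := hr i
        positivity
  have hswap : pairing f (hermiteFunMulti α) =
      (∏ i, (c (α i) : ℂ)) * ∫ θ, (∫ x, f x * gaussKernel (Z θ) x) * W θ ∂P := by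
    rw [pairing]
    simp only [hker, mul_left_comm (f _), integral_const_mul]
    congr 1
    simp only [← integral_const_mul, ← integral_mul_const]
    rw [integral_integral_swap hint]
    simp only [mul_assoc]
  rw [hswap, norm_mul]
  have hI : ‖∫ θ, (∫ x, f x * gaussKernel (Z θ) x) * W θ ∂P‖ ≤
      S * (∏ i, (r i ^ α i)⁻¹) * (2 * Real.pi) ^ d := by
    rw [← hPu]
    refine norm_integral_le_of_norm_le_const (Filter.Eventually.of_forall fun θ => ?_)
    rw [norm_mul, hWn]
    refine mul_le_mul_of_nonneg_right (hS _ (hZn θ)) (Finset.prod_nonneg fun i _ => ?_)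
    have := hr i
    positivity
  have hS0 : 0 ≤ S := (norm_nonneg _).trans (hS (fun i => r i) fun i => by simp [abs_of_pos (hr i)])
  have hr0 : 0 ≤ ∏ i, (r i ^ α i)⁻¹ := Finset.prod_nonneg fun i _ => by
    have := hr i
    positivity
  calc _ ≤ (∏ i, |c (α i)|) * (S * (∏ i, (r i ^ α i)⁻¹) * (2 * Real.pi) ^ d) := by
        rw [norm_prod]
        simp only [Complex.norm_real, Real.norm_eq_abs]
        gcongr
    _ = S * (∏ i, (r i ^ α i)⁻¹) * ∏ i, (|c (α i)| * (2 * Real.pi)) := by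
        rw [Finset.prod_mul_distrib, Finset.prod_const, Finset.card_univ, Fintype.card_fin]
        ring
    _ ≤ S * (∏ i, (r i ^ α i)⁻¹) * ∏ i, (Nat.factorial (α i) : ℝ) := by
        gcongr with i
        exact hcle _
    _ = _ := by
        simp only [div_eq_mul_inv, Finset.prod_mul_distrib]
        ring

/-! ### Choice of the radius -/

theorem exists_factorial_pow_le_exp_rpow {q ε : ℝ} (hq : 1 < q) (hε : 0 < ε) (d : ℕ) :
    ∃ K : ℝ, 0 < K ∧ ∀ n : ℕ, (Nat.factorial n : ℝ) ^ d ≤ K * Real.exp (ε * (n : ℝ) ^ q) := by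
  have ho := (isLittleO_log_rpow_atTop (sub_pos.2 hq)).bound
    (show 0 < ε / (d + 1) by positivity)
  have hev : ∀ᶠ n : ℕ in Filter.atTop,
      (Nat.factorial n : ℝ) ^ d * Real.exp (-(ε * (n : ℝ) ^ q)) ≤ 1 := by
    filter_upwards [tendsto_natCast_atTop_atTop.eventually ho, Filter.eventually_ge_atTop 1]
      with n hn h1
    have hn1 : (1 : ℝ) ≤ n := by exact_mod_cast h1
    have hn0 : (0 : ℝ) < n := by linarith
    rw [Real.norm_of_nonneg (Real.log_nonneg hn1), Real.norm_of_nonneg (by positivity)] at hn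
    have hfac : (Nat.factorial n : ℝ) ^ d ≤ Real.exp (d * (n * Real.log n)) := by
      calc (Nat.factorial n : ℝ) ^ d ≤ ((n : ℝ) ^ n) ^ d := by
            gcongr
            exact_mod_cast n.factorial_le_pow
        _ = _ := by
            rw [Real.exp_nat_mul, Real.exp_nat_mul, Real.exp_log hn0]
    have hlog : d * (n * Real.log n) ≤ ε * (n : ℝ) ^ q := by
      have h2 : (n : ℝ) ^ q = n * (n : ℝ) ^ (q - 1) := by
        rw [← Real.rpow_one_add' hn0.le (by linarith)]; ring_nf
      have h3 : d * (ε / (d + 1)) ≤ ε := by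
        rw [mul_div_assoc', div_le_iff₀ (by positivity)]
        nlinarith
      calc d * (n * Real.log n) ≤ d * (n * (ε / (d + 1) * (n : ℝ) ^ (q - 1))) := by gcongr
        _ = d * (ε / (d + 1)) * (n * (n : ℝ) ^ (q - 1)) := by ring
        _ ≤ ε * (n * (n : ℝ) ^ (q - 1)) := by gcongr
        _ = _ := by rw [h2]
    rw [Real.exp_neg, ← div_eq_mul_inv, div_le_one (Real.exp_pos _)]
    exact hfac.trans (Real.exp_le_exp.2 hlog)
  obtain ⟨K, hK⟩ := (Filter.isBoundedUnder_of_eventually_le hev).bddAbove_range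
  refine ⟨max K 1, by positivity, fun n => ?_⟩
  have h := (hK (Set.mem_range_self n)).trans (le_max_left K 1)
  rwa [Real.exp_neg, ← div_eq_mul_inv, div_le_iff₀ (Real.exp_pos _)] at h

/-- The minimum of `κ T ^ p - n T` for `p = 1 / (1 - 2 s)`, attained at
`T = (n / (κ p)) ^ (1 / (p - 1))`. -/
theorem exists_mul_rpow_sub_mul_eq {s κ n : ℝ} (hs0 : 0 < s) (hs1 : s < 1 / 2) (hκ : 0 < κ)
    (hn : 0 ≤ n) :
    ∃ T : ℝ, 0 ≤ T ∧ κ * T ^ (1 / (1 - 2 * s)) - n * T =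
      -(2 * s * (((1 - 2 * s) / κ) ^ ((1 - 2 * s) / (2 * s)) * n ^ (1 / (2 * s)))) := by
  have h1 : 0 < 1 - 2 * s := by linarith
  set β : ℝ := (1 - 2 * s) / (2 * s) with hβ
  have hβ0 : 0 < β := by positivity
  have hq : 1 / (2 * s) = β + 1 := by rw [hβ]; field_simp; ring
  have hβp : β * (1 / (1 - 2 * s)) = β + 1 := by rw [hβ]; field_simp; ring
  set b : ℝ := (1 - 2 * s) / κ with hb
  have hb0 : 0 < b := by positivity
  refine ⟨(b * n) ^ β, by positivity, ?_⟩
  have e1 : ((b * n) ^ β) ^ (1 / (1 - 2 * s)) = (b * n) ^ β * (b * n) := by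
    rw [← Real.rpow_mul (by positivity), hβp, Real.rpow_add_one' (by positivity) (by linarith)]
  have e2 : n ^ (1 / (2 * s)) = n ^ β * n := by
    rw [hq, Real.rpow_add_one' hn (by linarith)]
  have e3 : κ * b = 1 - 2 * s := by rw [hb]; field_simp
  rw [e1, e2, Real.mul_rpow hb0.le hn]
  linear_combination (b ^ β * n ^ β * n) * e3

/-! ### Hermite coefficients of the Hardy class -/

theorem IsHardyConstant.nonneg {E : Type*} [NormedAddCommGroup E] [InnerProductSpace ℝ E]
    [MeasureSpace E] {a c lam : ℝ} {w : ℝ → ℝ} {f : E → ℂ} {C : ℝ}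
    (h : IsHardyConstant a c lam w f C) : 0 ≤ C :=
  nonneg_of_mul_nonneg_left ((norm_nonneg _).trans (h.2 0)) (Real.exp_pos _)

/-- Hermite coefficients decay in their largest index alone, at the rate claimed in dimension one.
Without losses the optimal radius for that index would give twice the claimed rate; enlarging the
weight costs a factor `√2`, and the rest of the excess pays for the factorials. -/
theorem exists_norm_pairing_hermiteFunMulti_le {s lam : ℝ} (hs0 : 0 < s) (hs1 : s < 1 / 2)
    (hlam : 0 < lam) (d : ℕ) :
    ∃ K : ℝ, 0 < K ∧ ∀ f ∈ weightedHardyClass (EuclideanSpace ℝ (Fin d)) 1 1 lam (logWeight s),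
      ∀ C : ℝ, IsHardyConstant 1 1 lam (logWeight s) f C →
      ∀ (α : Fin d → ℕ) (j : Fin d), (∀ i, α i ≤ α j) → ‖pairing f (hermiteFunMulti α)‖ ≤
        K * C * Real.exp (-(((1 - 2 * s) / lam) ^ ((1 - 2 * s) / (2 * s)) *
          s * (α j : ℝ) ^ (1 / (2 * s)))) := by
  have h1 : 0 < 1 - 2 * s := by linarith
  set p : ℝ := 1 / (1 - 2 * s) with hp
  have hp0 : 0 < p := by positivity
  set β : ℝ := (1 - 2 * s) / (2 * s) with hβ
  have hβ0 : 0 < β := by positivity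
  set q : ℝ := 1 / (2 * s) with hq
  have hq1 : 1 < q := by rw [hq, lt_div_iff₀ (by positivity)]; linarith
  set A : ℝ := ((1 - 2 * s) / lam) ^ β with hA
  have hA0 : 0 < A := by positivity
  -- The loss `ρ` in the weight is used twice and costs a factor `(ρ * ρ) ^ β = √2` in the rate.
  set ρ : ℝ := 2 ^ (1 / (4 * β)) with hρ
  have hρ1 : 1 < ρ := Real.one_lt_rpow one_lt_two (by positivity)
  have hρβ : (ρ * ρ) ^ β = √2 := by
    rw [hρ, ← Real.rpow_add two_pos, ← Real.rpow_mul two_pos.le, Real.sqrt_eq_rpow]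
    congr 1
    field_simp
    norm_num
  have h2 : 1 < √2 := by simpa using Real.sqrt_lt_sqrt zero_le_one one_lt_two
  obtain ⟨K₁, hK₁, hker⟩ := exists_norm_integral_gaussKernel_le (ι := Fin d) hp0 hρ1 hlam.le
  obtain ⟨K₂, hK₂, hentire⟩ := exists_norm_le_of_gaussian_bounds (μ := ρ * lam) hp0
    (by positivity) hρ1
  obtain ⟨K₃, hK₃, hfac⟩ := exists_factorial_pow_le_exp_rpow hq1
    (show 0 < (√2 - 1) * (A * s) by have := sub_pos.2 h2; positivity) d
  refine ⟨K₂ * K₁ * K₃, by positivity, fun f hf C hC α j hj => ?_⟩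
  have hC0 := hC.nonneg
  have hfint : Integrable f := memLp_one_iff_integrable.1 hf.1
  have hf1 : ∀ᵐ x, ‖f x‖ ≤ C * Real.exp (-(‖x‖ ^ 2 / 2) + lam * Real.log (1 + ‖x‖) ^ p) := by
    simpa [logWeight, hp] using hC.1
  have hf2 : ∀ᵐ x, ‖unitaryFourier f x‖ ≤
      C * Real.exp (-(‖x‖ ^ 2 / 2) + lam * Real.log (1 + ‖x‖) ^ p) := by
    simpa [logWeight, hp] using Filter.Eventually.of_forall hC.2
  obtain ⟨T, hT, hTeq⟩ := exists_mul_rpow_sub_mul_eq hs0 hs1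
    (show 0 < ρ * (ρ * lam) by positivity) (Nat.cast_nonneg (α j))
  set r : Fin d → ℝ := fun i => if i = j then Real.exp T else 1 with hr
  have hr0 : ∀ i, 0 < r i := fun i => by
    simp only [hr]; split_ifs <;> positivity
  have hS : ∀ ζ : Fin d → ℂ, (∀ i, ‖ζ i‖ = r i) → ‖∫ x, f x * gaussKernel ζ x‖ ≤
      K₂ * (K₁ * C) * Real.exp (ρ * (ρ * lam) * T ^ p) := by
    intro ζ hζ
    have hle : ∀ i, i ≠ j → ‖ζ i‖ ≤ 1 := fun i hi => by simp [hζ, hr, hi]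
    have h := hentire (fun z => ∫ x, f x * gaussKernel (Function.update ζ j z) x) (K₁ * C)
      (differentiable_integral_gaussKernel hfint ζ j) (by positivity)
      (fun z => by
        simpa using hker f C hf1 hC0 j (Function.update ζ j z) fun i hi => by
          simpa [hi] using hle i hi)
      (fun z => by
        rw [integral_gaussKernel_eq_fourier hfint]
        simpa using hker _ C hf2 hC0 j (fun i => Complex.I * Function.update ζ j z i)
          fun i hi => by simpa [hi] using hle i hi)
      T (ζ j) hT (by simp [hζ, hr])
    simpa using h
  have hmain := norm_pairing_hermiteFunMulti_le hfint hr0 hS α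
  have hprod : ∏ i, ((Nat.factorial (α i) : ℝ) / r i ^ α i) ≤
      (Nat.factorial (α j) : ℝ) ^ d * Real.exp (-(α j * T)) := by
    have hden : ∏ i, r i ^ α i = Real.exp (α j * T) := by
      rw [Finset.prod_eq_single j (fun i _ hi => by simp [hr, hi]) (by simp), Real.exp_nat_mul]
      simp [hr]
    rw [Finset.prod_div_distrib, hden, Real.exp_neg, div_eq_mul_inv]
    gcongr
    calc ∏ i, (Nat.factorial (α i) : ℝ) ≤ ∏ i : Fin d, (Nat.factorial (α j) : ℝ) := by
          gcongr with i
          exact hj i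
      _ = _ := by simp
  have hrate : ρ * (ρ * lam) * T ^ p - α j * T = -(√2 * (A * s * (α j : ℝ) ^ q)) := by
    have h3 : ((1 - 2 * s) / (ρ * (ρ * lam))) ^ β = A / √2 := by
      rw [← hρβ, hA, ← Real.div_rpow (by positivity) (by positivity)]
      congr 1
      field_simp
    have h4 : (2 : ℝ) / √2 = √2 := Real.div_sqrt
    rw [hTeq, h3]
    linear_combination (-(s * A * (α j : ℝ) ^ q)) * h4
  calc _ ≤ K₂ * (K₁ * C) * Real.exp (ρ * (ρ * lam) * T ^ p) *
        (K₃ * Real.exp ((√2 - 1) * (A * s) * (α j : ℝ) ^ q) * Real.exp (-(α j * T))) := by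
        refine hmain.trans (mul_le_mul_of_nonneg_left (hprod.trans ?_) (by positivity))
        gcongr
        exact hfac _
    _ = K₂ * K₁ * K₃ * C * Real.exp ((ρ * (ρ * lam) * T ^ p - α j * T) +
        (√2 - 1) * (A * s) * (α j : ℝ) ^ q) := by
        rw [Real.exp_add, Real.exp_sub, Real.exp_neg]
        ring
    _ = _ := by
        rw [hrate]
        ring_nf

/-! ### Transport along isometries -/

section Transport

variable {E F : Type*} [NormedAddCommGroup E] [InnerProductSpace ℝ E] [FiniteDimensional ℝ E]
  [MeasurableSpace E] [BorelSpace E] [NormedAddCommGroup F] [InnerProductSpace ℝ F]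
  [FiniteDimensional ℝ F] [MeasurableSpace F] [BorelSpace F]

theorem unitaryFourier_comp_linearIsometryEquiv (e : F ≃ₗᵢ[ℝ] E) (f : E → ℂ) (ξ : F) :
    unitaryFourier (f ∘ e) ξ = unitaryFourier f (e ξ) := by
  rw [unitaryFourier, unitaryFourier, e.toLinearEquiv.finrank_eq,
    ← e.measurePreserving.integral_comp e.toHomeomorph.measurableEmbedding]
  simp only [e.inner_map_map, Function.comp]

theorem IsHardyConstant.comp_linearIsometryEquiv {a c lam C : ℝ} {w : ℝ → ℝ} {f : E → ℂ}
    (h : IsHardyConstant a c lam w f C) (e : F ≃ₗᵢ[ℝ] E) :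
    IsHardyConstant a c lam w (f ∘ e) C := by
  refine ⟨?_, fun ξ => ?_⟩
  · simpa using e.measurePreserving.quasiMeasurePreserving.ae h.1
  · rw [unitaryFourier_comp_linearIsometryEquiv, ← e.norm_map]
    exact h.2 _

theorem comp_linearIsometryEquiv_mem_weightedHardyClass {a c lam : ℝ} {w : ℝ → ℝ} {f : E → ℂ}
    (h : f ∈ weightedHardyClass E a c lam w) (e : F ≃ₗᵢ[ℝ] E) :
    f ∘ e ∈ weightedHardyClass F a c lam w := by
  obtain ⟨h1, h2, C, hC⟩ := h
  exact ⟨h1.comp_measurePreserving e.measurePreserving,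
    h2.comp_measurePreserving e.measurePreserving, C, hC.comp_linearIsometryEquiv e⟩

end Transport

theorem theorem1p2 (s : ℝ) (hs0 : 0 < s) (hs1 : s < 1 / 2) (lam : ℝ) (hlam : 0 < lam) :
    (∃ K : ℝ, 0 < K ∧ ∀ ε : ℝ, 0 < ε →
      ∀ f ∈ weightedHardyClass ℝ 1 1 lam (logWeight s),
      ∀ C : ℝ, IsHardyConstant 1 1 lam (logWeight s) f C →
      ∀ n : ℕ, ‖pairing f (hermiteFun n)‖ ≤
        K * C * Real.exp (-((1 - ε) * ((1 - 2 * s) / lam) ^ ((1 - 2 * s) / (2 * s)) *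
          s * (n : ℝ) ^ (1 / (2 * s))))) ∧
    (∀ d : ℕ, 1 ≤ d → ∃ K : ℝ, 0 < K ∧ ∀ ε : ℝ, 0 < ε →
      ∀ f ∈ weightedHardyClass (EuclideanSpace ℝ (Fin d)) 1 1 lam (logWeight s),
      ∀ C : ℝ, IsHardyConstant 1 1 lam (logWeight s) f C →
      ∀ α : Fin d → ℕ, ‖pairing f (hermiteFunMulti α)‖ ≤
        K * C * Real.exp (-((1 - ε) * ((1 - 2 * s) / lam) ^ ((1 - 2 * s) / (2 * s)) *
          (s / (2 * (d : ℝ))) * ∑ j, (α j : ℝ) ^ (1 / (2 * s))))) := by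
  have h1 : 0 < 1 - 2 * s := by linarith
  set A : ℝ := ((1 - 2 * s) / lam) ^ ((1 - 2 * s) / (2 * s)) with hA
  have hA0 : 0 < A := by positivity
  refine ⟨?_, fun d hd => ?_⟩
  · obtain ⟨K, hK, hmain⟩ := exists_norm_pairing_hermiteFunMulti_le hs0 hs1 hlam 1
    -- The bound holds with `ε = 0`, so `K` does not depend on `ε`.
    refine ⟨K, hK, fun ε hε f hf C hC n => ?_⟩
    have hC0 := hC.nonneg
    set e : EuclideanSpace ℝ (Fin 1) ≃ₗᵢ[ℝ] ℝ := (OrthonormalBasis.singleton (Fin 1) ℝ).repr.symm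
    have he : ∀ x, e x = x 0 := by
      intro x
      rw [show e x = _ from ((OrthonormalBasis.singleton (Fin 1) ℝ).sum_repr_symm x).symm]
      simp
    have hpair : pairing f (hermiteFun n) = pairing (f ∘ e) (hermiteFunMulti fun _ => n) := by
      rw [pairing, pairing,
        ← e.measurePreserving.integral_comp e.toHomeomorph.measurableEmbedding]
      simp [hermiteFunMulti, he]
    rw [hpair]
    refine (hmain _ (comp_linearIsometryEquiv_mem_weightedHardyClass hf e) C
      (hC.comp_linearIsometryEquiv e) (fun _ => n) 0 fun _ => le_rfl).trans ?_
    gcongr _ * Real.exp (-?_)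
    have : 0 ≤ ε * (A * s * (n : ℝ) ^ (1 / (2 * s))) := by positivity
    linarith
  · obtain ⟨K, hK, hmain⟩ := exists_norm_pairing_hermiteFunMulti_le hs0 hs1 hlam d
    refine ⟨K, hK, fun ε hε f hf C hC α => ?_⟩
    have hC0 := hC.nonneg
    have hd0 : (0 : ℝ) < d := by exact_mod_cast hd
    have : Nonempty (Fin d) := ⟨⟨0, hd⟩⟩
    obtain ⟨j, -, hj⟩ := Finset.exists_max_image Finset.univ α Finset.univ_nonempty
    refine (hmain f hf C hC α j fun i => hj i (Finset.mem_univ i)).trans ?_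
    gcongr _ * Real.exp (-?_)
    set σ : ℝ := ∑ j, (α j : ℝ) ^ (1 / (2 * s)) with hσ
    have hσ0 : 0 ≤ σ := by positivity
    have hσle : σ ≤ d * (α j : ℝ) ^ (1 / (2 * s)) := by
      calc σ ≤ ∑ i : Fin d, (α j : ℝ) ^ (1 / (2 * s)) := by
            rw [hσ]
            gcongr with i
            exact hj i (Finset.mem_univ i)
        _ = _ := by simp
    have hε0 : 0 ≤ ε * (A * (s / (2 * d)) * σ) := by positivity
    calc (1 - ε) * A * (s / (2 * d)) * σ ≤ A * (s / (2 * d)) * σ := by linarith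
      _ ≤ A * (s / (2 * d)) * (d * (α j : ℝ) ^ (1 / (2 * s))) := by gcongr
      _ = A * s * (α j : ℝ) ^ (1 / (2 * s)) / 2 := by field_simp
      _ ≤ A * s * (α j : ℝ) ^ (1 / (2 * s)) := half_le_self (by positivity)

end
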